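/- Let $k$ be a commutative ring and let $(U,A)$ be a left bialgebroid over $k$, with source $s$, target $t$, coproduct $\Delta$ and counit $\epsilon$ (with $\epsilon(1)=1$). The base algebra $A$ is a left $U$-module by $u\cdot a=\epsilon(u\,s(a))$, and each $\mathrm{Ext}^i_U(A,U)$ is a right $U$-module through the right multiplication of $U$ on the second argument. A quantisation $(U_h,A_h)$ of $(U,A)$ is an $h$-adic topological left bialgebroid over $k[[h]]$ (its coproduct takes values in the Takeuchi–Sweedler product inside the $h$-adic completion of $U_h\otimes_{A_h}U_h$) together with $k[[h]]$-linear isomorphisms $A_h\cong A[[h]]$ and $U_h\cong U[[h]]$ that induce modulo $h$ an algebra isomorphism $A_h/hA_h\cong A$ and, over it, an isomorphism $U_h/hU_h\cong U$ of left bialgebroids. Write $\pi:U_h\to U$ for the reduction. Theorem. Assume that $U$ is a (left) Noetherian ring, that $d\ge 0$ is an integer with $\mathrm{Ext}^i_U(A,U)=0$ for all $i\neq d$, and put $\Lambda:=\mathrm{Ext}^d_U(A,U)$. Let $(U_h,A_h)$ be a quantisation of $(U,A)$. Then: 1. $\mathrm{Ext}^i_{U_h}(A_h,U_h)=0$ for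 all $i\neq d$. 2. $\Lambda_h:=\mathrm{Ext}^d_{U_h}(A_h,U_h)$ is $h$-adically complete and separated and has no $h$-torsion, and there is a surjective additive map $\mathrm{red}:\Lambda_h\to\Lambda$ with kernel $h\Lambda_h$ such that $\mathrm{red}(x\cdot u)=\mathrm{red}(x)\cdot\pi(u)$ for all $x\in\Lambda_h$, $u\in U_h$. So $\Lambda_h/h\Lambda_h\cong\Lambda$, and the right $U_h$-action on $\Lambda_h$ quantises the right $U$-action on $\Lambda$ given by right multiplication. 3. If $\Lambda$ is projective as a $k$-module (for instance if $k$ is a field), then $\Lambda_h$ is topologically free: there is a $k[[h]]$-linear isomorphism $\Lambda_h\cong\Lambda[[h]]$ under which $\mathrm{red}$ is the map taking the constant coefficient. -/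

import Mathlib

open scoped TensorProduct PowerSeries

universe u v

noncomputable section

/-- The module `M[[h]]` of formal power series in `h` with coefficients in a `k`-module `M`. -/
def FormalSeries (M : Type*) : Type _ := ℕ → M

namespace FormalSeries

variable {k : Type*} [CommRing k] {M : Type*} [AddCommGroup M] [Module k M]

instance : AddCommGroup (FormalSeries M) := inferInstanceAs (AddCommGroup (ℕ → M))

/-- The coefficient of `h ^ n`. -/
def coeff (n : ℕ) (m : FormalSeries M) : M := m n

/-- The convolution action of `k[[h]]` on `M[[h]]`. -/
instance : SMul k⟦X⟧ (FormalSeries M) :=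
  ⟨fun f m n => ∑ p ∈ Finset.HasAntidiagonal.antidiagonal n, PowerSeries.coeff p.1 f • m p.2⟩

theorem coeff_smul (f : k⟦X⟧) (m : FormalSeries M) (n : ℕ) :
    coeff n (f • m) =
      ∑ p ∈ Finset.HasAntidiagonal.antidiagonal n, PowerSeries.coeff p.1 f • coeff p.2 m := rfl

theorem coeff_add (m m' : FormalSeries M) (n : ℕ) :
    coeff n (m + m') = coeff n m + coeff n m' := rfl

theorem coeff_zero (n : ℕ) : coeff n (0 : FormalSeries M) = 0 := rfl

theorem ext_coeff {M : Type*} {m m' : FormalSeries M} (H : ∀ n, coeff n m = coeff n m') : m = m' :=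
  funext H

instance : Module k⟦X⟧ (FormalSeries M) where
  one_smul m := by
    refine ext_coeff fun n => ?_
    rw [coeff_smul, Finset.sum_eq_single (0, n)]
    · simp
    · rintro ⟨i, j⟩ hij hne
      have hi : i ≠ 0 := by
        rintro rfl
        simp at hij
        exact hne (by simp [hij])
      simp [PowerSeries.coeff_one, hi]
    · simp
  mul_smul f g m := by
    refine ext_coeff fun n => ?_
    simp only [coeff_smul, PowerSeries.coeff_mul, Finset.sum_smul, Finset.smul_sum, mul_smul,
      Finset.sum_sigma']
    apply Finset.sum_nbij' (fun ⟨⟨_i, j⟩, ⟨a, b⟩⟩ ↦ ⟨(a, b + j), (b, j)⟩)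
      (fun ⟨⟨i, _j⟩, ⟨a, b⟩⟩ ↦ ⟨(i + a, b), (i, a)⟩) <;>
      grind [Finset.HasAntidiagonal.mem_antidiagonal]
  smul_zero f := ext_coeff fun n => by simp [coeff_smul, coeff_zero]
  smul_add f m m' := ext_coeff fun n => by
    simp [coeff_smul, coeff_add, smul_add, Finset.sum_add_distrib]
  add_smul f g m := ext_coeff fun n => by
    simp [coeff_smul, coeff_add, add_smul, Finset.sum_add_distrib]
  zero_smul m := ext_coeff fun n => by simp [coeff_smul, coeff_zero]

end FormalSeries

/-- An `A ⊗ Aᵒᵖ`-ring `U` over the commutative ground ring `R`: the algebra map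
`A ⊗ Aᵒᵖ → U` is given by its source `s` and target `t`, which have commuting images. -/
structure AeRing (R A U : Type*) [CommRing R] [Ring A] [Algebra R A] [Ring U] [Algebra R U] where
  s : A →ₐ[R] U
  t : Aᵐᵒᵖ →ₐ[R] U
  commute : ∀ (a : A) (b : Aᵐᵒᵖ), Commute (s a) (t b)

namespace AeRing

variable {R A U : Type*} [CommRing R] [Ring A] [Algebra R A] [Ring U] [Algebra R U]
  (E : AeRing R A U)

/-- The relations `(u ◁ a) ⊗ v = u ⊗ (a ▷ v)`, where `u ◁ a = t(a) u` and `a ▷ v = s(a) v`. -/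
def balanced₂ : Submodule R (U ⊗[R] U) :=
  Submodule.span R {w | ∃ (a : A) (u v : U),
    w = (E.t (MulOpposite.op a) * u) ⊗ₜ[R] v - u ⊗ₜ[R] (E.s a * v)}

/-- The tensor product `U_◁ ⊗_A ▷U`. -/
abbrev Tensor₂ : Type _ := (U ⊗[R] U) ⧸ E.balanced₂

/-- The pure tensor `u ⊗_A v`. -/
def tmul (u v : U) : E.Tensor₂ := E.balanced₂.mkQ (u ⊗ₜ[R] v)

/-- The relations of `U_◁ ⊗_A ▷U_◁ ⊗_A ▷U`. -/
def balanced₃ : Submodule R (U ⊗[R] (U ⊗[R] U)) :=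
  Submodule.span R
    ({w | ∃ (a : A) (u v x : U),
      w = (E.t (MulOpposite.op a) * u) ⊗ₜ[R] (v ⊗ₜ[R] x) - u ⊗ₜ[R] ((E.s a * v) ⊗ₜ[R] x)} ∪
    {w | ∃ (a : A) (u v x : U),
      w = u ⊗ₜ[R] ((E.t (MulOpposite.op a) * v) ⊗ₜ[R] x) - u ⊗ₜ[R] (v ⊗ₜ[R] (E.s a * x))})

/-- The triple tensor product `U_◁ ⊗_A ▷U_◁ ⊗_A ▷U`. -/
abbrev Tensor₃ : Type _ := (U ⊗[R] (U ⊗[R] U)) ⧸ E.balanced₃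

/-- The factorwise right multiplication `u ⊗_A v ↦ u x ⊗_A v y`. -/
def rmul (x y : U) : E.Tensor₂ →ₗ[R] E.Tensor₂ :=
  E.balanced₂.mapQ E.balanced₂
    (TensorProduct.map (LinearMap.mulRight R x) (LinearMap.mulRight R y)) (by
      refine Submodule.span_le.2 ?_
      rintro _ ⟨a, u, v, rfl⟩
      refine Submodule.subset_span ⟨a, u * x, v * y, ?_⟩
      simp [mul_assoc])

/-- The map `u ⊗_A v ↦ u ⊗_A v ⊗_A z`. -/
def tensRight (z : U) : E.Tensor₂ →ₗ[R] E.Tensor₃ :=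
  E.balanced₂.mapQ E.balanced₃
    ((TensorProduct.assoc R U U U).toLinearMap ∘ₗ (TensorProduct.mk R (U ⊗[R] U) U).flip z) (by
      refine Submodule.span_le.2 ?_
      rintro _ ⟨a, u, v, rfl⟩
      refine Submodule.subset_span (Or.inl ⟨a, u, v, z, ?_⟩)
      simp)

/-- The map `u ⊗_A v ↦ z ⊗_A u ⊗_A v`. -/
def tensLeft (z : U) : E.Tensor₂ →ₗ[R] E.Tensor₃ :=
  E.balanced₂.mapQ E.balanced₃ (TensorProduct.mk R U (U ⊗[R] U) z) (by
      refine Submodule.span_le.2 ?_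
      rintro _ ⟨a, u, v, rfl⟩
      refine Submodule.subset_span (Or.inr ⟨a, z, u, v, ?_⟩)
      simp [TensorProduct.tmul_sub])

end AeRing

/-- An `A ⊗ Aᵒᵖ`-ring with a left counit `ε`, satisfying
`ε(1) = 1`, `ε(a ▷ u ◁ b) = a ε(u) b` and `ε(u v) = ε(u s(ε(v))) = ε(u t(ε(v)))`. -/
structure CounitalAeRing (R A U : Type*) [CommRing R] [Ring A] [Algebra R A] [Ring U]
    [Algebra R U] extends AeRing R A U where
  counit : U →ₗ[R] A
  counit_one : counit 1 = 1
  counit_bimod : ∀ (a b : A) (u : U), counit (s a * t (MulOpposite.op b) * u) = a * counit u * b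
  counit_mul_s : ∀ u v : U, counit (u * v) = counit (u * s (counit v))
  counit_mul_t : ∀ u v : U, counit (u * v) = counit (u * t (MulOpposite.op (counit v)))

namespace CounitalAeRing

variable {R A U : Type*} [CommRing R] [Ring A] [Algebra R A] [Ring U] [Algebra R U]

/-- The base algebra `A`, regarded as a left `U`-module. -/
def Base (_C : CounitalAeRing R A U) : Type _ := A

variable (C : CounitalAeRing R A U)

instance : AddCommGroup C.Base := inferInstanceAs (AddCommGroup A)

/-- The left action `u · a = ε(u s(a))` of `U` on `A`. -/
instance : SMul U C.Base := ⟨fun u (a : A) => C.counit (u * C.s a)⟩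

theorem base_smul_def (u : U) (a : A) :
    (u • (show C.Base from a) : C.Base) = (C.counit (u * C.s a) : A) := rfl

theorem counit_s (a : A) : C.counit (C.s a) = a := by
  have := C.counit_bimod a 1 1
  simpa [C.counit_one] using this

instance : Module U C.Base where
  one_smul a := by
    change C.counit (1 * C.s a) = a
    exact (congrArg C.counit (one_mul _)).trans (C.counit_s a)
  mul_smul u v a := by
    exact (by intro a; rw [← C.counit_mul_s, mul_assoc] : ∀ a : A,
      C.counit (u * v * C.s a) = C.counit (u * C.s (C.counit (v * C.s a)))) a
  smul_zero u := by
    change C.counit (u * C.s 0) = 0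
    simp
  smul_add u a b := by
    exact (by simp [mul_add] : ∀ a b : A,
      C.counit (u * C.s (a + b)) = C.counit (u * C.s a) + C.counit (u * C.s b)) a b
  add_smul u v a := by
    exact (by simp [add_mul] : ∀ a : A,
      C.counit ((u + v) * C.s a) = C.counit (u * C.s a) + C.counit (v * C.s a)) a
  zero_smul a := by
    exact (by simp : ∀ a : A, C.counit (0 * C.s a) = 0) a

end CounitalAeRing

/-- A left bialgebroid `(U, A)` over the commutative ring `k`. The conditions on the coproduct
are written in Sweedler form, for an arbitrary expression `Δ u = ∑ i, x i ⊗_A y i`. -/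
structure LeftBialgebroid (k A U : Type*) [CommRing k] [Ring A] [Algebra k A] [Ring U]
    [Algebra k U] extends CounitalAeRing k A U where
  comul : U →ₗ[k] toAeRing.Tensor₂
  /-- `Δ(a ▷ u ◁ b) = a ▷ Δ(u) ◁ b`. -/
  comul_bimod : ∀ (a b : A) (u : U) (m : ℕ) (x y : Fin m → U),
    comul u = ∑ i, toAeRing.tmul (x i) (y i) →
    comul (s a * t (MulOpposite.op b) * u) =
      ∑ i, toAeRing.tmul (s a * x i) (t (MulOpposite.op b) * y i)
  /-- `(Δ ⊗ id) Δ = (id ⊗ Δ) Δ`. -/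
  coassoc : ∀ (u : U) (m : ℕ) (x y : Fin m → U),
    comul u = ∑ i, toAeRing.tmul (x i) (y i) →
    ∑ i, toAeRing.tensRight (y i) (comul (x i)) = ∑ i, toAeRing.tensLeft (x i) (comul (y i))
  /-- `(ε ⊗ id) Δ = id`. -/
  counit_left : ∀ (u : U) (m : ℕ) (x y : Fin m → U),
    comul u = ∑ i, toAeRing.tmul (x i) (y i) →
    ∑ i, s (counit (x i)) * y i = u
  /-- `(id ⊗ ε) Δ = id`. -/
  counit_right : ∀ (u : U) (m : ℕ) (x y : Fin m → U),
    comul u = ∑ i, toAeRing.tmul (x i) (y i) →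
    ∑ i, t (MulOpposite.op (counit (y i))) * x i = u
  /-- `Δ` takes values in the Takeuchi-Sweedler product. -/
  takeuchi : ∀ (u : U) (a : A),
    toAeRing.rmul (t (MulOpposite.op a)) 1 (comul u) = toAeRing.rmul 1 (s a) (comul u)
  comul_one : comul 1 = toAeRing.tmul 1 1
  /-- `Δ(v u) = Δ(v) Δ(u)`, with the factorwise product. -/
  comul_mul : ∀ (v u : U) (m : ℕ) (x y : Fin m → U),
    comul u = ∑ i, toAeRing.tmul (x i) (y i) →
    comul (v * u) = ∑ i, toAeRing.rmul (x i) (y i) (comul v)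

/-- The ideal `(h)` of `k[[h]]`. -/
abbrev hIdeal (k : Type*) [CommRing k] : Ideal k⟦X⟧ := Ideal.span {(PowerSeries.X : k⟦X⟧)}

namespace AeRing

variable {k A U : Type*} [CommRing k] [Ring A] [Algebra k⟦X⟧ A] [Ring U] [Algebra k⟦X⟧ U]
  (E : AeRing k⟦X⟧ A U)

/-- The `h`-adic completion of `U_◁ ⊗_A ▷U`. -/
abbrev CTensor₂ : Type _ := AdicCompletion (hIdeal k) E.Tensor₂

/-- The `h`-adic completion of `U_◁ ⊗_A ▷U_◁ ⊗_A ▷U`. -/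
abbrev CTensor₃ : Type _ := AdicCompletion (hIdeal k) E.Tensor₃

/-- The completed tensor `z` is congruent to `∑ i, x i ⊗_A y i` modulo `h ^ n`. -/
def Congr (n : ℕ) (z : E.CTensor₂) {m : ℕ} (x y : Fin m → U) : Prop :=
  AdicCompletion.eval (hIdeal k) E.Tensor₂ n z =
    Submodule.Quotient.mk (∑ i, E.tmul (x i) (y i))

end AeRing

/-- A topological (`h`-adic) left bialgebroid `(U, A)` over `k[[h]]`: the coproduct takes values
in the `h`-adically completed tensor product. The conditions on the coproduct are identities
in (completed) modules and are written in Sweedler form modulo `h ^ n`, for all `n`. -/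
structure TopLeftBialgebroid (k A U : Type*) [CommRing k] [Ring A] [Algebra k⟦X⟧ A] [Ring U]
    [Algebra k⟦X⟧ U] extends CounitalAeRing k⟦X⟧ A U where
  complete_base : IsAdicComplete (hIdeal k) A
  complete_total : IsAdicComplete (hIdeal k) U
  comul : U →ₗ[k⟦X⟧] toAeRing.CTensor₂
  /-- `Δ(a ▷ u ◁ b) = a ▷ Δ(u) ◁ b`. -/
  comul_bimod : ∀ (a b : A) (u : U) (n m : ℕ) (x y : Fin m → U),
    toAeRing.Congr n (comul u) x y →
    toAeRing.Congr n (comul (s a * t (MulOpposite.op b) * u))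
      (fun i => s a * x i) (fun i => t (MulOpposite.op b) * y i)
  /-- `(Δ ⊗ id) Δ = (id ⊗ Δ) Δ`. -/
  coassoc : ∀ (u : U) (n m : ℕ) (x y : Fin m → U), toAeRing.Congr n (comul u) x y →
    AdicCompletion.eval (hIdeal k) toAeRing.Tensor₃ n
      (∑ i, AdicCompletion.map (hIdeal k) (toAeRing.tensRight (y i)) (comul (x i))) =
    AdicCompletion.eval (hIdeal k) toAeRing.Tensor₃ n
      (∑ i, AdicCompletion.map (hIdeal k) (toAeRing.tensLeft (x i)) (comul (y i)))
  /-- `(ε ⊗ id) Δ = id`. -/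
  counit_left : ∀ (u : U) (n m : ℕ) (x y : Fin m → U), toAeRing.Congr n (comul u) x y →
    ∑ i, s (counit (x i)) * y i - u ∈ (hIdeal k ^ n • ⊤ : Submodule k⟦X⟧ U)
  /-- `(id ⊗ ε) Δ = id`. -/
  counit_right : ∀ (u : U) (n m : ℕ) (x y : Fin m → U), toAeRing.Congr n (comul u) x y →
    ∑ i, t (MulOpposite.op (counit (y i))) * x i - u ∈ (hIdeal k ^ n • ⊤ : Submodule k⟦X⟧ U)
  /-- `Δ` takes values in the completed Takeuchi-Sweedler product. -/
  takeuchi : ∀ (u : U) (a : A),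
    AdicCompletion.map (hIdeal k) (toAeRing.rmul (t (MulOpposite.op a)) 1) (comul u) =
      AdicCompletion.map (hIdeal k) (toAeRing.rmul 1 (s a)) (comul u)
  comul_one : comul 1 = AdicCompletion.of (hIdeal k) toAeRing.Tensor₂ (toAeRing.tmul 1 1)
  /-- `Δ(v u) = Δ(v) Δ(u)`, with the factorwise product. -/
  comul_mul : ∀ (v u : U) (n m : ℕ) (x y : Fin m → U), toAeRing.Congr n (comul u) x y →
    AdicCompletion.eval (hIdeal k) toAeRing.Tensor₂ n (comul (v * u)) =
    AdicCompletion.eval (hIdeal k) toAeRing.Tensor₂ n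
      (∑ i, AdicCompletion.map (hIdeal k) (toAeRing.rmul (x i) (y i)) (comul v))

/-- The topological left bialgebroid `Bh = (Uh, Ah)` is a quantisation of the left bialgebroid
`B = (U, A)`: there are `k[[h]]`-linear isomorphisms `Ah ≅ A[[h]]` and `Uh ≅ U[[h]]` whose
reductions modulo `h` are an algebra isomorphism `Ah / h Ah ≅ A` and an isomorphism
`Uh / h Uh ≅ U` of left bialgebroids over it. -/
structure Quantisation {k A U Ah Uh : Type*} [CommRing k] [Ring A] [Algebra k A] [Ring U]
    [Algebra k U] [Ring Ah] [Algebra k⟦X⟧ Ah] [Ring Uh] [Algebra k⟦X⟧ Uh]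
    (B : LeftBialgebroid k A U) (Bh : TopLeftBialgebroid k Ah Uh) where
  isoA : Ah ≃ₗ[k⟦X⟧] FormalSeries A
  isoU : Uh ≃ₗ[k⟦X⟧] FormalSeries U
  /-- The reduction `Ah → Ah / h Ah ≅ A`. -/
  redA : Ah →+* A
  /-- The reduction `Uh → Uh / h Uh ≅ U`. -/
  redU : Uh →+* U
  redA_apply : ∀ a, redA a = (isoA a).coeff 0
  redU_apply : ∀ u, redU u = (isoU u).coeff 0
  map_s : ∀ a, redU (Bh.s a) = B.s (redA a)
  map_t : ∀ a, redU (Bh.t (MulOpposite.op a)) = B.t (MulOpposite.op (redA a))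
  map_counit : ∀ u, redA (Bh.counit u) = B.counit (redU u)
  map_comul : ∀ (u : Uh) (m : ℕ) (x y : Fin m → Uh), Bh.toAeRing.Congr 1 (Bh.comul u) x y →
    B.comul (redU u) = ∑ i, B.toAeRing.tmul (redU (x i)) (redU (y i))

open CategoryTheory in
/-- The group `Ext^i_U(M, U)` of left `U`-modules. -/
def ExtReg (U M : Type v) [Ring U] [AddCommGroup M] [Module U M] (i : ℕ) : Type v :=
  Abelian.Ext (ModuleCat.of U M) (ModuleCat.of U U) i

namespace ExtReg

open CategoryTheory

variable {U M : Type v} [Ring U] [AddCommGroup M] [Module U M] {i : ℕ}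

instance : AddCommGroup (ExtReg U M i) :=
  inferInstanceAs (AddCommGroup (Abelian.Ext (ModuleCat.of U M) (ModuleCat.of U U) i))

/-- Right multiplication by `u`, an endomorphism of the left `U`-module `U`. -/
def rightMul (u : U) : ModuleCat.of U U ⟶ ModuleCat.of U U :=
  ModuleCat.ofHom (LinearMap.toSpanSingleton U U u)

theorem rightMul_one : rightMul (1 : U) = 𝟙 _ := by
  ext; simp [rightMul]

theorem rightMul_mul (u v : U) : rightMul (u * v) = rightMul u ≫ rightMul v := by
  ext; simp [rightMul]

theorem rightMul_add (u v : U) : rightMul (u + v) = rightMul u + rightMul v := by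
  ext; simp [rightMul]

theorem rightMul_zero : rightMul (0 : U) = 0 := by
  ext; simp [rightMul]

/-- The endomorphism of `Ext^i_U(M, U)` induced by right multiplication by `u`. -/
def act (u : U) (e : Abelian.Ext (ModuleCat.of U M) (ModuleCat.of U U) i) :
    Abelian.Ext (ModuleCat.of U M) (ModuleCat.of U U) i :=
  e.comp (Abelian.Ext.mk₀ (rightMul u)) (add_zero i)

section

variable (u v : U) (e e' : Abelian.Ext (ModuleCat.of U M) (ModuleCat.of U U) i)

theorem act_one : act 1 e = e := by
  rw [act, rightMul_one, Abelian.Ext.comp_mk₀_id]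

theorem act_mul : act (u * v) e = act v (act u e) := by
  rw [act, rightMul_mul, ← Abelian.Ext.mk₀_comp_mk₀, act, act,
    Abelian.Ext.comp_assoc_of_third_deg_zero]

theorem act_add : act (u + v) e = act u e + act v e := by
  rw [act, rightMul_add, Abelian.Ext.mk₀_add, Abelian.Ext.comp_add, act, act]

theorem act_zero : act 0 e = 0 := by
  rw [act, rightMul_zero, Abelian.Ext.mk₀_zero, Abelian.Ext.comp_zero]

theorem act_map_add : act u (e + e') = act u e + act u e' := by
  rw [act, Abelian.Ext.add_comp, act, act]

theorem act_map_zero :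
    act u (0 : Abelian.Ext (ModuleCat.of U M) (ModuleCat.of U U) i) = 0 := by
  rw [act, Abelian.Ext.zero_comp]

end

/-- The right action of `U` on `Ext^i_U(M, U)` induced by the right multiplication of `U`
on the second argument. -/
instance : Module Uᵐᵒᵖ (ExtReg U M i) where
  smul u e := act u.unop e
  one_smul e := act_one e
  mul_smul u v e := act_mul v.unop u.unop e
  smul_zero u := act_map_zero u.unop
  smul_add u e e' := act_map_add u.unop e e'
  add_smul u v e := act_add u.unop v.unop e
  zero_smul e := act_zero e

/-- If `U` is an algebra over a commutative ring `R`, then `Ext^i_U(M, U)` is an `R`-module by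
restriction of its right `U`-action along `R → U`. -/
instance {R : Type*} [CommRing R] [Algebra R U] : Module R (ExtReg U M i) :=
  Module.compHom _ (algebraMap R Uᵐᵒᵖ)

theorem algebraMap_smul_def {R : Type*} [CommRing R] [Algebra R U] (r : R) (e : ExtReg U M i) :
    r • e = MulOpposite.op (algebraMap R U r) • e := rfl

end ExtReg

end

noncomputable section

/-- An additive endomorphism `h` of `N` is derived complete if all equations
`s n = a n + h (s (n + 1))` have a unique solution; morally `s n = ∑ j, h ^ j (a (n + j))`. -/
def IsDerivedComplete {N : Type*} [AddCommGroup N] (h : N →+ N) : Prop :=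
  ∀ a : ℕ → N, ∃! s : ℕ → N, ∀ n, s n = a n + h (s (n + 1))

namespace IsDerivedComplete

variable {N : Type*} [AddCommGroup N] {h : N →+ N}

theorem eq_zero (H : IsDerivedComplete h) {s : ℕ → N} (hs : ∀ n, s n = h (s (n + 1))) (n : ℕ) :
    s n = 0 := by
  have := (H 0).unique (y₁ := s) (y₂ := 0) (by simpa using hs) (by simp)
  exact congrFun this n

theorem of_exists_of_eq_zero (h₁ : ∀ a : ℕ → N, ∃ s : ℕ → N, ∀ n, s n = a n + h (s (n + 1)))
    (h₂ : ∀ s : ℕ → N, (∀ n, s n = h (s (n + 1))) → ∀ n, s n = 0) : IsDerivedComplete h := by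
  intro a
  obtain ⟨s, hs⟩ := h₁ a
  refine ⟨s, hs, fun t ht => funext fun n => sub_eq_zero.1 (h₂ (t - s) (fun m => ?_) n)⟩
  simp only [Pi.sub_apply, map_sub]
  rw [hs m, ht m, add_sub_add_left_eq_sub]

theorem of_subsingleton [Subsingleton N] : IsDerivedComplete h :=
  of_exists_of_eq_zero (fun _ => ⟨0, fun _ => Subsingleton.elim _ _⟩)
    fun _ _ _ => Subsingleton.elim _ _

theorem of_addEquiv {N' : Type*} [AddCommGroup N'] {h' : N' →+ N'} (e : N ≃+ N')
    (he : ∀ x, e (h x) = h' (e x)) (H : IsDerivedComplete h') : IsDerivedComplete h := by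
  refine of_exists_of_eq_zero (fun a => ?_) fun s hs n => ?_
  · obtain ⟨s, hs, -⟩ := H (e ∘ a)
    refine ⟨e.symm ∘ s, fun n => e.injective ?_⟩
    simp [he, hs n]
  · have := H.eq_zero (s := e ∘ s) (fun m => by
      rw [Function.comp_apply, Function.comp_apply, ← he, ← hs]) n
    simpa using this

/-- A derived complete endomorphism that is surjective lives on the zero group. -/
theorem subsingleton_of_surjective (H : IsDerivedComplete h) (hs : Function.Surjective h) :
    Subsingleton N := by
  refine subsingleton_of_forall_eq 0 fun x => ?_
  let s : ℕ → N := fun n => Nat.rec x (fun _ y => Function.surjInv hs y) n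
  exact H.eq_zero (s := s) (fun n => (Function.surjInv_eq hs (s n)).symm) 0

end IsDerivedComplete

namespace FormalSeries

variable {k : Type*} [CommRing k] {M : Type*} [AddCommGroup M] [Module k M]

theorem coeff_zero_X_smul (m : FormalSeries M) : coeff 0 ((PowerSeries.X : k⟦X⟧) • m) = 0 := by
  simp [coeff_smul]

theorem coeff_succ_X_smul (m : FormalSeries M) (n : ℕ) :
    coeff (n + 1) ((PowerSeries.X : k⟦X⟧) • m) = coeff n m := by
  rw [coeff_smul, Finset.sum_eq_single (1, n)]
  · simp
  · rintro ⟨i, j⟩ hij hne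
    have hi : i ≠ 1 := by
      rintro rfl
      rw [Finset.HasAntidiagonal.mem_antidiagonal] at hij
      exact hne (Prod.ext rfl (by dsimp only at hij ⊢; omega))
    simp [PowerSeries.coeff_X, hi]
  · simp [add_comm]

theorem coeff_zero_smul (f : k⟦X⟧) (m : FormalSeries M) :
    coeff 0 (f • m) = PowerSeries.constantCoeff f • coeff 0 m := by
  simp [coeff_smul]

theorem X_smul_injective :
    Function.Injective fun m : FormalSeries M => (PowerSeries.X : k⟦X⟧) • m := by
  intro m m' H
  refine ext_coeff fun n => ?_
  rw [← coeff_succ_X_smul (k := k) m, ← coeff_succ_X_smul (k := k) m']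
  exact congrArg (coeff (n + 1)) H

theorem coeff_zero_eq_zero_iff (m : FormalSeries M) :
    coeff 0 m = 0 ↔ ∃ m', m = (PowerSeries.X : k⟦X⟧) • m' := by
  constructor
  · intro H
    obtain ⟨m', hm'⟩ : ∃ m' : FormalSeries M, ∀ n, coeff n m' = coeff (n + 1) m :=
      ⟨fun n => coeff (n + 1) m, fun _ => rfl⟩
    refine ⟨m', ext_coeff fun n => ?_⟩
    cases n with
    | zero => rw [coeff_zero_X_smul, H]
    | succ n => rw [coeff_succ_X_smul, hm']
  · rintro ⟨m', rfl⟩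
    exact coeff_zero_X_smul m'

variable (k M) in
theorem isDerivedComplete_X :
    IsDerivedComplete (DistribSMul.toAddMonoidHom (FormalSeries M) (PowerSeries.X : k⟦X⟧)) := by
  refine IsDerivedComplete.of_exists_of_eq_zero (fun a => ?_) fun s hs => ?_
  · refine ⟨fun n j => ∑ i ∈ Finset.range (j + 1), a (n + i) (j - i), fun n => ext_coeff fun j => ?_⟩
    rw [coeff_add]
    cases j with
    | zero =>
      erw [coeff_zero_X_smul]
      simp [coeff]
    | succ j =>
      erw [coeff_succ_X_smul]
      simp only [coeff]
      rw [Finset.sum_range_succ', add_comm]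
      congr 1
      refine Finset.sum_congr rfl fun i _ => ?_
      rw [Nat.add_sub_add_right, add_right_comm, add_assoc]
  · suffices H : ∀ j n, coeff j (s n) = 0 from fun n => ext_coeff fun j => H j n
    intro j
    induction j with
    | zero => intro n; rw [hs n]; exact coeff_zero_X_smul _
    | succ j ih => intro n; rw [hs n]; exact (coeff_succ_X_smul _ _).trans (ih _)

end FormalSeries

section PowerSeriesModule

variable {k : Type*} [CommRing k] {N : Type*} [AddCommGroup N] [Module k⟦X⟧ N]

theorem mem_hIdeal_pow_smul_top_iff (n : ℕ) (x : N) :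
    x ∈ (hIdeal k ^ n • ⊤ : Submodule k⟦X⟧ N) ↔ ∃ y : N, x = (PowerSeries.X : k⟦X⟧) ^ n • y := by
  rw [hIdeal, Ideal.span_singleton_pow, Submodule.ideal_span_singleton_smul,
    Submodule.mem_smul_pointwise_iff_exists]
  simp [eq_comm]

theorem isAdicComplete_of_isDerivedComplete
    (H : IsDerivedComplete (DistribSMul.toAddMonoidHom N (PowerSeries.X : k⟦X⟧)))
    (tf : ∀ x : N, (PowerSeries.X : k⟦X⟧) • x = 0 → x = 0) : IsAdicComplete (hIdeal k) N := by
  have tfn : ∀ (n : ℕ) (x : N), (PowerSeries.X : k⟦X⟧) ^ n • x = 0 → x = 0 := by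
    intro n
    induction n with
    | zero => simp
    | succ n ih =>
      intro x hx
      rw [pow_succ', mul_smul] at hx
      exact ih _ (tf _ hx)
  refine { toIsHausdorff := ⟨fun x hx => ?_⟩, toIsPrecomplete := ⟨fun f hf => ?_⟩ }
  · have : ∀ n, ∃ y : N, x = (PowerSeries.X : k⟦X⟧) ^ n • y := fun n => by
      rw [← mem_hIdeal_pow_smul_top_iff]
      simpa [SModEq.zero] using hx n
    choose y hy using this
    have h0 : ∀ n, y n = 0 := H.eq_zero fun n => by
      refine sub_eq_zero.1 (tfn n _ ?_)
      change (PowerSeries.X : k⟦X⟧) ^ n • (y n - (PowerSeries.X : k⟦X⟧) • y (n + 1)) = 0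
      rw [smul_sub, ← mul_smul, ← pow_succ, ← hy, ← hy, sub_self]
    simpa [h0] using hy 0
  · have : ∀ n, ∃ a : N, f (n + 1) - f n = (PowerSeries.X : k⟦X⟧) ^ n • a := fun n => by
      rw [← mem_hIdeal_pow_smul_top_iff, ← SModEq.sub_mem]
      exact (hf (Nat.le_succ n)).symm
    choose a ha using this
    obtain ⟨s, hs, -⟩ := H a
    refine ⟨f 0 + s 0, fun n => ?_⟩
    rw [SModEq.comm, SModEq.sub_mem, mem_hIdeal_pow_smul_top_iff]
    refine ⟨s n, ?_⟩
    induction n with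
    | zero => simp
    | succ n ih =>
      have h1 : s n = a n + (PowerSeries.X : k⟦X⟧) • s (n + 1) := hs n
      rw [h1, smul_add, ← ha, ← mul_smul, ← pow_succ] at ih
      rw [← sub_eq_zero] at ih ⊢
      rw [← ih]
      abel

theorem exists_equiv_formalSeries {M : Type*} [AddCommGroup M] [Module k M] [Module.Projective k M]
    (H : IsDerivedComplete (DistribSMul.toAddMonoidHom N (PowerSeries.X : k⟦X⟧)))
    (tf : ∀ x : N, (PowerSeries.X : k⟦X⟧) • x = 0 → x = 0) (red : N →+ M)
    (red_surj : Function.Surjective red)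
    (red_eq_zero : ∀ x, red x = 0 ↔ ∃ y, x = (PowerSeries.X : k⟦X⟧) • y)
    (red_smul : ∀ (f : k⟦X⟧) (x : N), red (f • x) = PowerSeries.constantCoeff f • red x) :
    ∃ iso : N ≃ₗ[k⟦X⟧] FormalSeries M, ∀ x, red x = (iso x).coeff 0 := by
  let _ : Module k N := Module.compHom N (PowerSeries.C (R := k))
  have smul_def : ∀ (c : k) (x : N), c • x = (PowerSeries.C c) • x := fun _ _ => rfl
  let redₗ : N →ₗ[k] M :=
    { red with map_smul' := fun c x => by simp [smul_def, red_smul] }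
  obtain ⟨σ, hσ⟩ := Module.projective_lifting_property redₗ LinearMap.id red_surj
  have red_σ : ∀ m, red (σ m) = m := fun m => LinearMap.congr_fun hσ m
  have tail : ∀ x : N, ∃ y, x = σ (red x) + (PowerSeries.X : k⟦X⟧) • y := fun x => by
    obtain ⟨y, hy⟩ := (red_eq_zero (x - σ (red x))).1 (by simp [red_σ])
    exact ⟨y, by rw [← hy]; abel⟩
  choose T hT using tail
  have T_unique : ∀ (m : M) (y : N), T (σ m + (PowerSeries.X : k⟦X⟧) • y) = y := fun m y => by
    have h1 := hT (σ m + (PowerSeries.X : k⟦X⟧) • y)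
    have h2 : red (σ m + (PowerSeries.X : k⟦X⟧) • y) = m := by simp [red_σ, red_smul]
    rw [h2, add_right_inj, ← sub_eq_zero, ← smul_sub] at h1
    exact (sub_eq_zero.1 (tf _ h1)).symm
  have T_eq : ∀ (x y : N) (m : M), x = σ m + (PowerSeries.X : k⟦X⟧) • y → T x = y := by
    rintro _ y m rfl
    exact T_unique m y
  have T_add : ∀ x y, T (x + y) = T x + T y := fun x y => by
    refine T_eq _ _ (red x + red y) ?_
    rw [map_add, smul_add]
    conv_lhs => rw [hT x, hT y]
    abel
  have T_smul : ∀ (c : k) (f : k⟦X⟧) (x : N),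
      T ((PowerSeries.C c + PowerSeries.X * f) • x) = c • T x + f • x := fun c f x => by
    refine T_eq _ _ (c • red x) ?_
    rw [add_smul, ← smul_def, mul_smul, map_smul, smul_add]
    conv_lhs => rw [hT x, smul_add, ← hT x]
    rw [smul_def c (_ • _), smul_def c (T x), smul_comm (PowerSeries.C c), add_assoc]
  let c : ℕ → N → M := fun n x => red (T^[n] x)
  have c_zero : ∀ x, c 0 x = red x := fun _ => rfl
  have c_succ : ∀ n x, c (n + 1) x = c n (T x) := fun _ _ => rfl
  have c_add : ∀ n x y, c n (x + y) = c n x + c n y := by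
    intro n
    induction n with
    | zero => exact fun x y => map_add red x y
    | succ n ih => intro x y; rw [c_succ, T_add, ih]; rfl
  have c_smul' : ∀ n (a : k) x, c n (a • x) = a • c n x := by
    intro n
    induction n with
    | zero => exact fun a x => map_smul redₗ a x
    | succ n ih =>
      intro a x
      have := T_smul a 0 x
      rw [mul_zero, add_zero, zero_smul, add_zero, ← smul_def] at this
      rw [c_succ, this, ih]; rfl
  have c_smul : ∀ n (f : k⟦X⟧) x, c n (f • x) =
      ∑ p ∈ Finset.HasAntidiagonal.antidiagonal n, PowerSeries.coeff p.1 f • c p.2 x := by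
    intro n
    induction n with
    | zero => intro f x; simp [c_zero, red_smul]
    | succ n ih =>
      intro f x
      obtain ⟨g, hg⟩ : ∃ g, f = PowerSeries.C (PowerSeries.constantCoeff f) + PowerSeries.X * g :=
        ⟨_, (PowerSeries.eq_X_mul_shift_add_const f).trans (add_comm _ _)⟩
      have hgc : ∀ i, PowerSeries.coeff (i + 1) f = PowerSeries.coeff i g := fun i => by
        rw [hg]
        simp
      rw [Finset.Nat.sum_antidiagonal_succ, c_succ]
      conv_lhs => rw [hg, T_smul, c_add, c_smul', ih]
      simp [hgc, c_succ]
  let Φ : N →ₗ[k⟦X⟧] FormalSeries M :=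
    { toFun := fun x n => c n x
      map_add' := fun x y => FormalSeries.ext_coeff fun n => c_add n x y
      map_smul' := fun f x => FormalSeries.ext_coeff fun n => c_smul n f x }
  refine ⟨LinearEquiv.ofBijective Φ ⟨?_, ?_⟩, fun x => rfl⟩
  · refine (injective_iff_map_eq_zero Φ).2 fun x hx => ?_
    refine H.eq_zero (s := fun n => T^[n] x) (fun n => ?_) 0
    have h1 : red (T^[n] x) = 0 := congrFun hx n
    have h2 := hT (T^[n] x)
    rw [h1, map_zero, zero_add, ← Function.iterate_succ_apply' T] at h2
    exact h2
  · intro m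
    obtain ⟨s, hs, -⟩ := H fun n => σ (m n)
    have hs' : ∀ n, s n = σ (m n) + (PowerSeries.X : k⟦X⟧) • s (n + 1) := hs
    have h1 : ∀ n, T^[n] (s 0) = s n := by
      intro n
      induction n with
      | zero => rfl
      | succ n ih => rw [Function.iterate_succ_apply', ih, T_eq _ _ _ (hs' n)]
    refine ⟨s 0, funext fun n => ?_⟩
    change red (T^[n] (s 0)) = m n
    rw [h1, hs' n]
    simp [red_σ, red_smul]

end PowerSeriesModule

/-- An abelian group `C` with a derived complete injective endomorphism `h` and an
identification `red` of `C / h C` with `Cb`. -/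
structure CompleteReduction (C Cb : Type*) [AddCommGroup C] [AddCommGroup Cb] where
  h : C →+ C
  red : C →+ Cb
  h_injective : Function.Injective h
  complete : IsDerivedComplete h
  red_surjective : Function.Surjective red
  red_eq_zero_iff : ∀ c, red c = 0 ↔ ∃ c', c = h c'

/-- An identification of `E` with the cohomology of `A → B → C` at `B`. -/
structure CohomologyOf {A B C : Type*} [AddCommGroup A] [AddCommGroup B] [AddCommGroup C]
    (d : A →+ B) (d' : B →+ C) (E : Type*) [AddCommGroup E] where
  cl : d'.ker →+ E
  cl_surjective : Function.Surjective cl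
  cl_eq_zero_iff : ∀ x, cl x = 0 ↔ ∃ a, d a = x

theorem CohomologyOf.exact_iff_subsingleton {A B C : Type*} [AddCommGroup A] [AddCommGroup B]
    [AddCommGroup C] {d : A →+ B} {d' : B →+ C} {E : Type*} [AddCommGroup E]
    (H : CohomologyOf d d' E) : (∀ x, d' x = 0 → ∃ a, d a = x) ↔ Subsingleton E := by
  constructor
  · refine fun h => subsingleton_of_forall_eq 0 fun e => ?_
    obtain ⟨x, rfl⟩ := H.cl_surjective e
    exact (H.cl_eq_zero_iff x).2 (h x x.2)
  · intro _ x hx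
    exact (H.cl_eq_zero_iff ⟨x, hx⟩).1 (Subsingleton.elim _ _)

namespace CompleteReduction

variable {A Ab B Bb C Cb : Type*} [AddCommGroup A] [AddCommGroup Ab] [AddCommGroup B]
  [AddCommGroup Bb] [AddCommGroup C] [AddCommGroup Cb]
  (QA : CompleteReduction A Ab) (QB : CompleteReduction B Bb) (QC : CompleteReduction C Cb)
  {d : A →+ B} {d' : B →+ C} {db : Ab →+ Bb} {db' : Bb →+ Cb}

/-- The reductions of `A` and `B` are compatible with `d : A → B` and `db : Ab → Bb`. -/
structure Compatible (QA : CompleteReduction A Ab) (QB : CompleteReduction B Bb) (d : A →+ B)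
    (db : Ab →+ Bb) : Prop where
  h_comm : ∀ a, d (QA.h a) = QB.h (d a)
  red_comm : ∀ a, QB.red (d a) = db (QA.red a)

theorem red_h (a : A) : QA.red (QA.h a) = 0 := (QA.red_eq_zero_iff _).2 ⟨a, rfl⟩

variable {QA QB QC}

theorem Compatible.solution_mem_ker (H : Compatible QA QB d db) {a s : ℕ → A}
    (ha : ∀ n, d (a n) = 0) (hs : ∀ n, s n = a n + QA.h (s (n + 1))) (n : ℕ) : d (s n) = 0 :=
  QB.complete.eq_zero (s := fun n => d (s n))
    (fun m => by rw [hs m, map_add, ha, zero_add, H.h_comm]) n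

/-- A cocycle modulo `h` which is a coboundary modulo `h` lifts to a cocycle. -/
theorem Compatible.exists_lift_of_exact_red (H : Compatible QA QB d db)
    (hd : ∀ a, d' (d a) = 0) (hex : ∀ x, db' x = 0 → ∃ a, db a = x)
    (H' : Compatible QB QC d' db') (b : B) (hb : QC.red (d' b) = 0) :
    ∃ z b', d' z = 0 ∧ b = z + QB.h b' := by
  rw [H'.red_comm] at hb
  obtain ⟨ab, hab⟩ := hex _ hb
  obtain ⟨a, rfl⟩ := QA.red_surjective ab
  obtain ⟨b', hb'⟩ := (QB.red_eq_zero_iff (b - d a)).1 (by rw [map_sub, H.red_comm, hab, sub_self])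
  exact ⟨d a, b', hd a, by rw [← hb']; abel⟩

/-- A cocycle modulo `h` lifts to a cocycle if the next cohomology group vanishes. -/
theorem Compatible.exists_lift_of_exact (H : Compatible QA QB d db)
    (H' : Compatible QB QC d' db') (hd : ∀ a, d' (d a) = 0)
    (hex : ∀ x, d' x = 0 → ∃ a, d a = x) (a : A) (ha : QB.red (d a) = 0) :
    ∃ z a', d z = 0 ∧ a = z + QA.h a' := by
  obtain ⟨b, hb⟩ := (QB.red_eq_zero_iff _).1 ha
  obtain ⟨a', rfl⟩ := hex b (QC.h_injective (by rw [← H'.h_comm, ← hb, hd, map_zero]))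
  exact ⟨a - QA.h a', a', by rw [map_sub, hb, H.h_comm, sub_self], by abel⟩

section

variable {E Eb : Type*} [AddCommGroup E] [AddCommGroup Eb] (HE : CohomologyOf d d' E)
  (HEb : CohomologyOf db db' Eb) (H : Compatible QA QB d db) (H' : Compatible QB QC d' db')

include H' in
theorem Compatible.h_mem_ker (x : d'.ker) : d' (QB.h x) = 0 := by
  rw [H'.h_comm, x.2, map_zero]

include H' in
theorem Compatible.red_mem_ker (x : d'.ker) : db' (QB.red x) = 0 := by
  rw [← H'.red_comm, x.2, map_zero]

variable {hE : E →+ E} (hE_cl : ∀ x : d'.ker, hE (HE.cl x) = HE.cl ⟨QB.h x, H'.h_mem_ker x⟩)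

include H hE_cl

theorem Compatible.isDerivedComplete_cohomology : IsDerivedComplete hE := by
  refine IsDerivedComplete.of_exists_of_eq_zero (fun e => ?_) fun e he n => ?_
  · choose x hx using fun n => HE.cl_surjective (e n)
    obtain ⟨s, hs, -⟩ := QB.complete fun n => x n
    refine ⟨fun n => HE.cl ⟨s n, H'.solution_mem_ker (fun n => (x n).2) hs n⟩, fun n => ?_⟩
    rw [hE_cl, ← hx, ← map_add]
    exact congrArg HE.cl (Subtype.ext (hs n))
  · choose x hx using fun n => HE.cl_surjective (e n)
    have h1 : ∀ n, ∃ a, d a = (x n : B) - QB.h (x (n + 1)) := fun n => by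
      refine (HE.cl_eq_zero_iff (x n - ⟨QB.h (x (n + 1)), H'.h_mem_ker _⟩)).1 ?_
      rw [map_sub, ← hE_cl, hx, hx, ← he, sub_self]
    choose a ha using h1
    obtain ⟨t, ht, -⟩ := QA.complete a
    have h2 := QB.complete.eq_zero (s := fun n => x n - d (t n)) (fun n => by
      rw [ht n, map_add, ha, H.h_comm, map_sub]
      abel) n
    rw [← hx n, HE.cl_eq_zero_iff]
    exact ⟨t n, (sub_eq_zero.1 h2).symm⟩

theorem Compatible.eq_zero_of_h_eq_zero
    (hlift : ∀ a, QB.red (d a) = 0 → ∃ z a', d z = 0 ∧ a = z + QA.h a')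
    (e : E) (he : hE e = 0) : e = 0 := by
  obtain ⟨x, rfl⟩ := HE.cl_surjective e
  rw [hE_cl, HE.cl_eq_zero_iff] at he
  obtain ⟨a, ha⟩ := he
  obtain ⟨z, a', hz, rfl⟩ := hlift a (by rw [ha]; exact QB.red_h _)
  rw [map_add, hz, zero_add, H.h_comm] at ha
  exact (HE.cl_eq_zero_iff x).2 ⟨a', QB.h_injective ha⟩

include HEb in
theorem Compatible.subsingleton_cohomology (hd : ∀ a, d' (d a) = 0) [hs : Subsingleton Eb] :
    Subsingleton E := by
  refine (H.isDerivedComplete_cohomology HE H' hE_cl).subsingleton_of_surjective fun e => ?_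
  obtain ⟨x, rfl⟩ := HE.cl_surjective e
  obtain ⟨ab, hab⟩ := HEb.exact_iff_subsingleton.2 hs _ (H'.red_mem_ker x)
  obtain ⟨a, rfl⟩ := QA.red_surjective ab
  obtain ⟨b, hb⟩ := (QB.red_eq_zero_iff (x - d a)).1 (by rw [map_sub, H.red_comm, hab, sub_self])
  have hb' : d' b = 0 := QC.h_injective (by rw [← H'.h_comm, ← hb, map_sub, hd, x.2]; simp)
  refine ⟨HE.cl ⟨b, hb'⟩, ?_⟩
  rw [hE_cl, ← sub_eq_zero, ← map_sub, HE.cl_eq_zero_iff]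
  refine ⟨-a, ?_⟩
  rw [AddSubgroup.coe_sub]
  dsimp only
  rw [← hb, map_neg]
  abel

theorem Compatible.exists_red_cohomology (hd : ∀ a, d' (d a) = 0)
    (hlift : ∀ b, QC.red (d' b) = 0 → ∃ z b', d' z = 0 ∧ b = z + QB.h b') :
    ∃ red : E →+ Eb, Function.Surjective red ∧ (∀ e, red e = 0 ↔ ∃ e', e = hE e') ∧
      ∀ x : d'.ker, red (HE.cl x) = HEb.cl ⟨QB.red x, H'.red_mem_ker x⟩ := by
  let ρ : d'.ker →+ Eb := HEb.cl.comp
    ((QB.red.comp d'.ker.subtype).codRestrict db'.ker H'.red_mem_ker)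
  have hρ : ∀ x, ρ x = HEb.cl ⟨QB.red x, H'.red_mem_ker x⟩ := fun _ => rfl
  have hker : HE.cl.ker ≤ ρ.ker := fun x hx => by
    obtain ⟨a, ha⟩ := (HE.cl_eq_zero_iff x).1 hx
    exact (HEb.cl_eq_zero_iff _).2 ⟨QA.red a, by rw [← H.red_comm, ha]; rfl⟩
  let red := HE.cl.liftOfSurjective HE.cl_surjective ⟨ρ, hker⟩
  have hred : ∀ x, red (HE.cl x) = ρ x :=
    HE.cl.liftOfRightInverse_comp_apply _ (Function.rightInverse_surjInv HE.cl_surjective)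
      ⟨ρ, hker⟩
  refine ⟨red, fun eb => ?_, fun e => ?_, fun x => (hred x).trans (hρ x)⟩
  · obtain ⟨⟨bb, hbb⟩, rfl⟩ := HEb.cl_surjective eb
    obtain ⟨b, rfl⟩ := QB.red_surjective bb
    obtain ⟨z, b', hz, rfl⟩ := hlift b (by rw [H'.red_comm]; exact hbb)
    refine ⟨HE.cl ⟨z, hz⟩, ?_⟩
    rw [hred, hρ]
    have h1 : QB.red z = QB.red (z + QB.h b') := by rw [map_add, QB.red_h, add_zero]
    exact congrArg HEb.cl (Subtype.ext h1)
  · obtain ⟨x, rfl⟩ := HE.cl_surjective e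
    rw [hred, hρ, HEb.cl_eq_zero_iff]
    constructor
    · rintro ⟨ab, hab⟩
      obtain ⟨a, rfl⟩ := QA.red_surjective ab
      obtain ⟨b, hb⟩ := (QB.red_eq_zero_iff (x - d a)).1
        (by rw [map_sub, H.red_comm]; exact sub_eq_zero.2 hab.symm)
      have hb' : d' b = 0 := QC.h_injective (by rw [← H'.h_comm, ← hb, map_sub, hd, x.2]; simp)
      refine ⟨HE.cl ⟨b, hb'⟩, ?_⟩
      rw [hE_cl, ← sub_eq_zero, ← map_sub, HE.cl_eq_zero_iff]
      refine ⟨a, ?_⟩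
      rw [AddSubgroup.coe_sub]
      dsimp only
      rw [← hb]
      abel
    · rintro ⟨e', he'⟩
      obtain ⟨y, rfl⟩ := HE.cl_surjective e'
      rw [hE_cl, ← sub_eq_zero, ← map_sub, HE.cl_eq_zero_iff] at he'
      obtain ⟨a, ha⟩ := he'
      refine ⟨QA.red a, ?_⟩
      rw [← H.red_comm, ha, AddSubgroup.coe_sub, map_sub, QB.red_h, sub_zero]

end

end CompleteReduction

section ExtCocycles

open CategoryTheory Abelian CochainComplex HomComplex

universe w v' u'

variable {C : Type u'} [Category.{v'} C] [Abelian C] {X : C}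

namespace CategoryTheory.ProjectiveResolution

variable (P : ProjectiveResolution X) (Y : C)

theorem extMk_eq_zero_iff_zero [HasExt.{w} C] (f : P.complex.X 0 ⟶ Y)
    (hf : P.complex.d 1 0 ≫ f = 0) : P.extMk f 1 rfl hf = 0 ↔ f = 0 := by
  constructor
  · intro h
    rw [← P.extEquivCohomologyClass.apply_eq_iff_eq, extEquivCohomologyClass_extMk,
      extEquivCohomologyClass_zero, CohomologyClass.mk_eq_zero_iff,
      Cocycle.toSingleMk_mem_coboundaries_iff _ _ _ _ _ 1 (by lia)] at h
    obtain ⟨g, hg⟩ := h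
    have h1 : P.cochainComplex.d (-(0 : ℕ)) 1 = 0 :=
      (P.cochainComplex.isZero_of_isStrictlyLE 0 1).eq_of_tgt _ _
    rw [h1, Limits.zero_comp] at hg
    rw [← cancel_epi (P.cochainComplexXIso (-(0 : ℕ)) 0 rfl).hom, Limits.comp_zero, ← hg]
  · rintro rfl
    exact P.extMk_zero 1 rfl

/-- The cochains `Hom(P, Y)`, shifted by one degree and extended by zero. -/
def HomCochain : ℕ → Type v'
  | 0 => PUnit
  | n + 1 => P.complex.X n ⟶ Y

instance : ∀ n, AddCommGroup (P.HomCochain Y n)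
  | 0 => inferInstanceAs (AddCommGroup PUnit)
  | n + 1 => inferInstanceAs (AddCommGroup (P.complex.X n ⟶ Y))

instance : Subsingleton (P.HomCochain Y 0) := inferInstanceAs (Subsingleton PUnit)

/-- The differential of `HomCochain`. -/
def homD : ∀ n, P.HomCochain Y n →+ P.HomCochain Y (n + 1)
  | 0 => 0
  | n + 1 =>
    { toFun := fun f : P.complex.X n ⟶ Y => P.complex.d (n + 1) n ≫ f
      map_zero' := Limits.comp_zero
      map_add' := fun f g => Preadditive.comp_add _ _ _ _ f g }

theorem homD_homD (n : ℕ) (f : P.HomCochain Y n) : P.homD Y (n + 1) (P.homD Y n f) = 0 := by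
  cases n with
  | zero => rw [Subsingleton.elim f 0, map_zero, map_zero]
  | succ n =>
    have h : ∀ g : P.complex.X n ⟶ Y,
        P.complex.d (n + 2) (n + 1) ≫ P.complex.d (n + 1) n ≫ g = 0 := by simp
    exact h f

/-- `Ext` as the cohomology of `HomCochain`. -/
def cohomologyOfExt [HasExt.{w} C] (n : ℕ) :
    CohomologyOf (P.homD Y n) (P.homD Y (n + 1)) (Ext.{w} X Y n) where
  cl :=
    { toFun := fun f => P.extMk (show P.complex.X n ⟶ Y from f.1) (n + 1) rfl f.2
      map_zero' := P.extMk_zero _ _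
      map_add' := fun f g => (P.add_extMk _ _ _ _ _ _).symm }
  cl_surjective e := by
    obtain ⟨f, hf, rfl⟩ := P.extMk_surjective e (n + 1) rfl
    exact ⟨⟨f, hf⟩, rfl⟩
  cl_eq_zero_iff f := by
    cases n with
    | zero =>
      refine (P.extMk_eq_zero_iff_zero Y _ f.2).trans ⟨fun h => ⟨0, ?_⟩, ?_⟩
      · rw [map_zero]; exact h.symm
      · rintro ⟨a, ha⟩; exact ha.symm
    | succ n => exact P.extMk_eq_zero_iff _ (n + 1 + 1) rfl f.2 n rfl

end CategoryTheory.ProjectiveResolution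

/-- A chain complex `K` of projectives with an augmentation to `X` that is exact is a
projective resolution. -/
def CategoryTheory.ProjectiveResolution.ofExact (K : ChainComplex C ℕ)
    (hK : ∀ n, Projective (K.X n)) (ε : K.X 0 ⟶ X) (w : K.d 1 0 ≫ ε = 0) (hε : Epi ε)
    (h₀ : (ShortComplex.mk _ _ w).Exact)
    (hs : ∀ n, (ShortComplex.mk _ _ (K.d_comp_d (n + 2) (n + 1) n)).Exact) :
    ProjectiveResolution X where
  complex := K
  projective := hK
  π := (ChainComplex.toSingle₀Equiv _ _).symm ⟨ε, w⟩
  quasiIso := ⟨fun n => by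
    cases n
    · rw [ChainComplex.quasiIsoAt₀_iff, ShortComplex.quasiIso_iff_of_zeros']
      · refine (ShortComplex.exact_and_epi_g_iff_of_iso ?_).2
          ⟨h₀, hε⟩
        exact ShortComplex.isoMk (Iso.refl _) (Iso.refl _) (Iso.refl _)
          ((Category.id_comp _).trans (Category.comp_id _).symm)
          ((Category.id_comp ε).trans
            ((ChainComplex.toSingle₀Equiv_symm_apply_f_zero ε w).symm.trans
              (Category.comp_id _).symm))
      · exact K.shape _ _ (by simp)
      · rfl
      · rfl
    · rename_i n
      rw [quasiIsoAt_iff_exactAt']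
      · exact (HomologicalComplex.exactAt_iff' _ (n + 2) (n + 1) n (by simp)
          (by simp)).2 (hs n)
      · apply ChainComplex.exactAt_succ_single_obj⟩

end ExtCocycles

/-- A surjective ring homomorphism `R → S` with kernel generated by a central element `h`. -/
structure CentralQuotient (R S : Type*) [Ring R] [Ring S] where
  π : R →+* S
  h : R
  surjective : Function.Surjective π
  comm : ∀ r, h * r = r * h
  eq_zero_iff : ∀ r, π r = 0 ↔ ∃ r', r = h * r'

namespace CentralQuotient

variable {R S : Type*} [Ring R] [Ring S] (q : CentralQuotient R S)

theorem map_h : q.π q.h = 0 := (q.eq_zero_iff _).2 ⟨1, (mul_one _).symm⟩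

section

variable (M : Type*) [AddCommGroup M] [Module R M]

/-- Multiplication by `h` as an `R`-linear map. -/
def mulH : M →ₗ[R] M where
  toFun x := q.h • x
  map_add' := smul_add _
  map_smul' r x := by simp [← mul_smul, q.comm]

/-- The reduction `M / h M`. -/
def Red : Type _ := M ⧸ LinearMap.range (q.mulH M)

instance : AddCommGroup (q.Red M) := inferInstanceAs (AddCommGroup (M ⧸ LinearMap.range (q.mulH M)))

instance moduleRed : Module R (q.Red M) :=
  inferInstanceAs (Module R (M ⧸ LinearMap.range (q.mulH M)))

variable {M} in
theorem smul_eq_smul {r r' : R} (hr : q.π r = q.π r') (x : q.Red M) : r • x = r' • x := by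
  rw [← sub_eq_zero, ← map_sub, q.eq_zero_iff] at hr
  obtain ⟨y, hy⟩ := hr
  rw [← sub_eq_zero, ← sub_smul, hy]
  obtain ⟨m, rfl⟩ := Submodule.mkQ_surjective (LinearMap.range (q.mulH M)) x
  exact (Submodule.Quotient.mk_eq_zero _).2 ⟨y • m, (mul_smul _ _ _).symm⟩

instance : SMul S (q.Red M) := ⟨fun s x => Function.surjInv q.surjective s • x⟩

variable {M} in
theorem π_smul (r : R) (x : q.Red M) : q.π r • x = r • x :=
  q.smul_eq_smul (Function.surjInv_eq q.surjective _) x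

instance : Module S (q.Red M) where
  one_smul x := by rw [← map_one q.π, q.π_smul, one_smul]
  mul_smul s t x := by
    obtain ⟨r, rfl⟩ := q.surjective s
    obtain ⟨r', rfl⟩ := q.surjective t
    rw [← map_mul, q.π_smul, q.π_smul, q.π_smul, mul_smul]
  smul_zero s := by
    obtain ⟨r, rfl⟩ := q.surjective s
    rw [q.π_smul, smul_zero]
  smul_add s x y := by
    obtain ⟨r, rfl⟩ := q.surjective s
    rw [q.π_smul, q.π_smul, q.π_smul, smul_add]
  add_smul s t x := by
    obtain ⟨r, rfl⟩ := q.surjective s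
    obtain ⟨r', rfl⟩ := q.surjective t
    rw [← map_add, q.π_smul, q.π_smul, q.π_smul, add_smul]
  zero_smul x := by rw [← map_zero q.π, q.π_smul, zero_smul]

/-- The projection `M → M / h M`. -/
def proj : M →ₛₗ[q.π] q.Red M where
  toFun := (LinearMap.range (q.mulH M)).mkQ
  map_add' := map_add _
  map_smul' r x := (map_smul _ r x).trans (q.π_smul r _).symm

theorem proj_surjective : Function.Surjective (q.proj M) := Submodule.mkQ_surjective _

variable {M} in
theorem proj_eq_zero_iff (x : M) : q.proj M x = 0 ↔ ∃ y, x = q.h • y :=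
  (Submodule.Quotient.mk_eq_zero _).trans (by simp [mulH, eq_comm])

end

section

variable {M N : Type*} [AddCommGroup M] [Module R M] [AddCommGroup N] [Module S N]

/-- A semilinear map to an `S`-module factors through `M / h M`. -/
def lift (f : M →ₛₗ[q.π] N) : q.Red M →ₗ[S] N :=
  let g : q.Red M →+ N := QuotientAddGroup.lift (LinearMap.range (q.mulH M)).toAddSubgroup
    f.toAddMonoidHom (by
      rintro _ ⟨y, rfl⟩
      exact (f.map_smulₛₗ q.h y).trans (by rw [q.map_h, zero_smul]))
  { g with
    map_smul' := fun s x => by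
      obtain ⟨r, rfl⟩ := q.surjective s
      obtain ⟨m, rfl⟩ := q.proj_surjective M x
      rw [← LinearMap.map_smulₛₗ]
      exact f.map_smulₛₗ r m }

@[simp]
theorem lift_proj (f : M →ₛₗ[q.π] N) (x : M) : q.lift f (q.proj M x) = f x := rfl

theorem hom_ext {f g : q.Red M →ₗ[S] N} (H : ∀ x, f (q.proj M x) = g (q.proj M x)) : f = g := by
  ext x
  obtain ⟨m, rfl⟩ := q.proj_surjective M x
  exact H m

/-- The projection `R → S` as a semilinear map. -/
def πₗ : R →ₛₗ[q.π] S where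
  toFun := q.π
  map_add' := map_add _
  map_smul' := map_mul _

theorem projective_red [Module.Projective R M] : Module.Projective S (q.Red M) := by
  obtain ⟨s, hs⟩ := Module.projective_def.1 ‹Module.Projective R M›
  let i : q.Red M →ₗ[S] (M →₀ S) := q.lift ((Finsupp.mapRange.linearMap q.πₗ).comp s)
  refine Module.Projective.of_split i (Finsupp.linearCombination S (q.proj M))
    (q.hom_ext fun x => ?_)
  have key : ∀ y : M →₀ R,
      Finsupp.linearCombination S (q.proj M) (Finsupp.mapRange.linearMap q.πₗ y) =
        q.proj M (Finsupp.linearCombination R id y) := by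
    intro y
    induction y using Finsupp.induction_linear with
    | zero => simp
    | add f g hf hg => simp only [map_add, hf, hg]
    | single m r => simp [πₗ, LinearMap.map_smulₛₗ]
  simp only [LinearMap.comp_apply, i, lift_proj, LinearMap.id_apply, key]
  rw [hs x]

end

end CentralQuotient

namespace CentralQuotient

open CategoryTheory

variable {R S : Type v} [Ring R] [Ring S] (q : CentralQuotient R S)

/-- The functor `M ↦ M / h M`. -/
def redFunctor : ModuleCat.{v} R ⥤ ModuleCat.{v} S where
  obj M := ModuleCat.of S (q.Red M)
  map {M M'} f := ModuleCat.ofHom (q.lift ((q.proj M').comp f.hom))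
  map_id M := by
    ext : 1
    exact q.hom_ext fun x => rfl
  map_comp f g := by
    ext : 1
    exact q.hom_ext fun x => rfl

instance : q.redFunctor.Additive where
  map_add {M M' f g} := by
    ext : 1
    exact q.hom_ext fun x => map_add (q.proj M') (f.hom x) (g.hom x)

/-- The reduction modulo `h` of a projective resolution of an `h`-torsion-free module `X`
is a projective resolution of `X / h X`. -/
def redResolution {X : Type v} [AddCommGroup X] [Module R X]
    (P : ProjectiveResolution (ModuleCat.of R X)) (hreg : ∀ r, q.h * r = 0 → r = 0)
    (tf : ∀ x : X, q.h • x = 0 → x = 0) {Xb : Type v} [AddCommGroup Xb] [Module S Xb]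
    (ρ : X →ₛₗ[q.π] Xb) (ρ_surj : Function.Surjective ρ)
    (ρ_eq_zero : ∀ x, ρ x = 0 → ∃ y, x = q.h • y) :
    ProjectiveResolution (ModuleCat.of S Xb) := by
  have tfP : ∀ n (x : P.complex.X n), q.h • x = 0 → x = 0 := fun n x hx => by
    obtain ⟨s, hs⟩ := Module.projective_def.1
      ((IsProjective.iff_projective (P.complex.X n)).2 (P.projective n))
    have h1 : q.h • s x = 0 := by rw [← map_smul, hx, map_zero]
    have h2 : s x = 0 := by
      ext m
      refine hreg _ ?_
      simpa using DFunLike.congr_fun h1 m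
    rw [← hs x, h2, map_zero]
  let ε : P.complex.X 0 ⟶ ModuleCat.of R X := P.π.f 0
  have ε_surj : Function.Surjective ε.hom := (ModuleCat.epi_iff_surjective _).1
    (inferInstanceAs (Epi (P.π.f 0)))
  have ε_exact : ∀ x, ε.hom x = 0 → ∃ y, (P.complex.d 1 0).hom y = x :=
    (ShortComplex.moduleCat_exact_iff _).1 P.exact₀
  have d_exact : ∀ n x, (P.complex.d (n + 1) n).hom x = 0 →
      ∃ y, (P.complex.d (n + 2) (n + 1)).hom y = x :=
    fun n => (ShortComplex.moduleCat_exact_iff _).1 (P.exact_succ n)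
  have hε : ∀ y, ε.hom ((P.complex.d 1 0).hom y) = 0 := fun y =>
    ConcreteCategory.congr_hom P.complex_d_comp_π_f_zero y
  have hd : ∀ n y, (P.complex.d (n + 1) n).hom ((P.complex.d (n + 2) (n + 1)).hom y) = 0 :=
    fun n y => ConcreteCategory.congr_hom (P.complex.d_comp_d (n + 2) (n + 1) n) y
  have lift_boundary : ∀ n (x : P.complex.X (n + 1)) (y : P.complex.X n),
      (P.complex.d (n + 1) n).hom x = q.h • y →
      (∃ z, (P.complex.d (n + 1) n).hom z = y) →
      ∃ w, q.proj _ x = q.proj (P.complex.X (n + 1)) ((P.complex.d (n + 2) (n + 1)).hom w) := by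
    rintro n x _ hx ⟨z, rfl⟩
    obtain ⟨w, hw⟩ := d_exact n (x - q.h • z) (by rw [map_sub, hx, map_smul, sub_self])
    refine ⟨w, ?_⟩
    rw [← sub_eq_zero, ← map_sub, proj_eq_zero_iff]
    exact ⟨z, by rw [hw]; abel⟩
  let εb : q.Red (P.complex.X 0) →ₗ[S] Xb := q.lift (ρ.comp ε.hom)
  have w : q.redFunctor.map (P.complex.d 1 0) ≫ ModuleCat.ofHom εb = 0 := by
    ext : 1
    refine q.hom_ext fun x => ?_
    change ρ (ε.hom ((P.complex.d 1 0).hom x)) = 0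
    rw [hε, map_zero]
  have εb_epi : Epi (ModuleCat.ofHom εb) := by
    refine (ModuleCat.epi_iff_surjective _).2 fun y => ?_
    obtain ⟨x, rfl⟩ := ρ_surj y
    obtain ⟨x, rfl⟩ := ε_surj x
    exact ⟨q.proj _ x, rfl⟩
  refine ProjectiveResolution.ofExact ((q.redFunctor.mapHomologicalComplex _).obj P.complex)
    (fun n => ?_) (ModuleCat.ofHom εb) w εb_epi ?_ fun n => ?_
  · have := (IsProjective.iff_projective (P.complex.X n)).2 (P.projective n)
    exact (IsProjective.iff_projective _).1 (q.projective_red (M := P.complex.X n))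
  · refine (ShortComplex.moduleCat_exact_iff _).2 fun x hx => ?_
    obtain ⟨x, rfl⟩ := q.proj_surjective (P.complex.X 0) x
    obtain ⟨y, hy⟩ := ρ_eq_zero _ hx
    obtain ⟨y, rfl⟩ := ε_surj y
    obtain ⟨z, hz⟩ := ε_exact (x - q.h • y) (by rw [map_sub, hy, map_smul, sub_self])
    refine ⟨q.proj _ z, ?_⟩
    change q.proj _ ((P.complex.d 1 0).hom z) = _
    rw [← sub_eq_zero, ← map_sub, proj_eq_zero_iff]
    exact ⟨-y, by rw [hz, smul_neg]; abel⟩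
  · refine (ShortComplex.moduleCat_exact_iff _).2 fun x hx => ?_
    obtain ⟨x, rfl⟩ := q.proj_surjective (P.complex.X (n + 1)) x
    obtain ⟨y, hy⟩ := (q.proj_eq_zero_iff ((P.complex.d (n + 1) n).hom x)).1 hx
    obtain ⟨w, hw⟩ := lift_boundary n x y hy (by
      cases n with
      | zero => exact ε_exact y (tf _ (by rw [← map_smul, ← hy, hε]))
      | succ n => exact d_exact n y (tfP _ _ (by rw [← map_smul, ← hy, hd])))
    exact ⟨q.proj _ w, hw.symm⟩

end CentralQuotient

namespace CentralQuotient

open CategoryTheory Abelian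

variable {R S : Type v} [Ring R] [Ring S] (q : CentralQuotient R S)

variable (hreg : ∀ r, q.h * r = 0 → r = 0)

include hreg in
theorem mul_h_injective {r r' : R} (H : q.h * r = q.h * r') : r = r' :=
  sub_eq_zero.1 (hreg _ (by rw [mul_sub, H, sub_self]))

/-- The morphism `M / h M → S` induced by a morphism `M → R`. -/
def redHom (M : ModuleCat.{v} R) :
    (M ⟶ ModuleCat.of R R) →+ (ModuleCat.of S (q.Red M) ⟶ ModuleCat.of S S) where
  toFun f := ModuleCat.ofHom (q.lift (q.πₗ.comp f.hom))
  map_zero' := by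
    ext : 1
    exact q.hom_ext fun x => map_zero q.π
  map_add' f g := by
    ext : 1
    exact q.hom_ext fun x => map_add q.π (f.hom x) (g.hom x)

theorem redHom_apply_proj (M : ModuleCat.{v} R) (f : M ⟶ ModuleCat.of R R) (x : M) :
    (q.redHom M f).hom (q.proj M x) = q.π (f.hom x) := rfl

theorem redHom_comp_rightMul (M : ModuleCat.{v} R) (f : M ⟶ ModuleCat.of R R) (u : R) :
    q.redHom M (f ≫ ExtReg.rightMul u) = q.redHom M f ≫ ExtReg.rightMul (q.π u) := by
  ext : 1
  exact q.hom_ext fun x => map_mul q.π (f.hom x) u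

theorem redHom_comp {M M' : ModuleCat.{v} R} (g : M' ⟶ M) (f : M ⟶ ModuleCat.of R R) :
    q.redHom M' (g ≫ f) = q.redFunctor.map g ≫ q.redHom M f := by
  ext : 1
  exact q.hom_ext fun x => rfl

theorem redHom_surjective (M : ModuleCat.{v} R) [Module.Projective R M] :
    Function.Surjective (q.redHom M) := by
  intro g
  let _ : Module R S := Module.compHom S q.π
  let πR : R →ₗ[R] S := { toFun := q.π, map_add' := map_add _, map_smul' := map_mul _ }
  let g' : M →ₗ[R] S :=
    { toFun := fun x => g.hom (q.proj M x)
      map_add' := fun x y => by rw [map_add, map_add]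
      map_smul' := fun r x => by
        rw [LinearMap.map_smulₛₗ, map_smul]; rfl }
  obtain ⟨f, hf⟩ := Module.projective_lifting_property πR g' q.surjective
  refine ⟨ModuleCat.ofHom f, ?_⟩
  ext : 1
  exact q.hom_ext fun x => LinearMap.congr_fun hf x

include hreg in
theorem redHom_eq_zero_iff (M : ModuleCat.{v} R) (f : M ⟶ ModuleCat.of R R) :
    q.redHom M f = 0 ↔ ∃ f', f = f' ≫ ExtReg.rightMul q.h := by
  constructor
  · intro H
    have h1 : ∀ x, ∃ r, f.hom x = q.h * r := fun x => by
      rw [← q.eq_zero_iff, ← q.redHom_apply_proj, H]; rfl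
    choose f' hf' using h1
    refine ⟨ModuleCat.ofHom
      { toFun := f'
        map_add' := fun x y => q.mul_h_injective hreg (by rw [← hf', mul_add, ← hf', ← hf', map_add])
        map_smul' := fun r x => q.mul_h_injective hreg (by
          rw [← hf', map_smul, hf', RingHom.id_apply, smul_eq_mul, smul_eq_mul, ← mul_assoc,
            ← mul_assoc, q.comm]) }, ?_⟩
    ext x
    exact (hf' x).trans (q.comm _)
  · rintro ⟨f', rfl⟩
    rw [redHom_comp_rightMul, q.map_h, ExtReg.rightMul_zero, Limits.comp_zero]

theorem isDerivedComplete_hom (hR : IsDerivedComplete (AddMonoidHom.mulLeft q.h))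
    (M : ModuleCat.{v} R) : IsDerivedComplete
      (AddMonoidHom.mk' (fun f : M ⟶ ModuleCat.of R R => f ≫ ExtReg.rightMul q.h)
        fun f g => Preadditive.add_comp _ _ _ f g _) := by
  refine IsDerivedComplete.of_exists_of_eq_zero (fun a => ?_) fun s hs n => ?_
  · choose s hs hs' using fun x : M => hR fun n => (a n).hom x
    have hs : ∀ x n, s x n = (a n).hom x + q.h * s x (n + 1) := hs
    have hadd : ∀ x y, s (x + y) = s x + s y := fun x y => by
      refine (hs' _ _ fun n => ?_).symm
      simp only [Pi.add_apply, AddMonoidHom.coe_mulLeft]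
      rw [hs x n, hs y n, map_add, mul_add]
      abel
    have hsmul : ∀ (r : R) x, s (r • x) = r • s x := fun r x => by
      refine (hs' _ _ fun n => ?_).symm
      simp only [Pi.smul_apply, AddMonoidHom.coe_mulLeft, smul_eq_mul]
      rw [hs x n, map_smul, mul_add, ← mul_assoc, ← mul_assoc, q.comm]
      rfl
    refine ⟨fun n => ModuleCat.ofHom
      { toFun := fun x => s x n
        map_add' := fun x y => by rw [hadd]; rfl
        map_smul' := fun r x => by rw [hsmul]; rfl }, fun n => ?_⟩
    ext x
    refine (hs x n).trans ?_
    rw [q.comm]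
    rfl
  · ext x
    refine hR.eq_zero (s := fun n => (s n).hom x) (fun n => ?_) n
    dsimp only
    rw [hs n]
    exact (q.comm _).symm

/-- `Hom(M, R)` reduces modulo `h` to `Hom(M / h M, S)` for projective `M`. -/
def homReduction (hR : IsDerivedComplete (AddMonoidHom.mulLeft q.h)) (M : ModuleCat.{v} R)
    [Module.Projective R M] :
    CompleteReduction (M ⟶ ModuleCat.of R R) (ModuleCat.of S (q.Red M) ⟶ ModuleCat.of S S) where
  h := AddMonoidHom.mk' (fun f => f ≫ ExtReg.rightMul q.h)
    fun f g => Preadditive.add_comp _ _ _ f g _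
  red := q.redHom M
  h_injective := by
    refine (injective_iff_map_eq_zero _).2 fun f hf => ?_
    ext x
    refine hreg _ ((q.comm _).trans ?_)
    exact ConcreteCategory.congr_hom hf x
  complete := q.isDerivedComplete_hom hR M
  red_surjective := q.redHom_surjective M
  red_eq_zero_iff := q.redHom_eq_zero_iff hreg M

section Main

variable (hR : IsDerivedComplete (AddMonoidHom.mulLeft q.h))
  {X : Type v} [AddCommGroup X] [Module R X] (P : ProjectiveResolution (ModuleCat.of R X))
  (tf : ∀ x : X, q.h • x = 0 → x = 0) {Xb : Type v} [AddCommGroup Xb] [Module S Xb]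
  (ρ : X →ₛₗ[q.π] Xb) (ρ_surj : Function.Surjective ρ) (ρ_eq_zero : ∀ x, ρ x = 0 → ∃ y, x = q.h • y)

/-- The cochains computing `Ext(X, R)` reduce to cochains computing `Ext(X / h X, S)`. -/
def cochainReduction : ∀ n, CompleteReduction (P.HomCochain (ModuleCat.of R R) n)
    ((q.redResolution P hreg tf ρ ρ_surj ρ_eq_zero).HomCochain (ModuleCat.of S S) n)
  | 0 =>
    { h := 0
      red := 0
      h_injective := Function.injective_of_subsingleton _
      complete := IsDerivedComplete.of_subsingleton
      red_surjective := fun _ => ⟨0, Subsingleton.elim _ _⟩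
      red_eq_zero_iff := fun c => by simp [Subsingleton.elim c 0] }
  | n + 1 =>
    have := (IsProjective.iff_projective (P.complex.X n)).2 (P.projective n)
    q.homReduction hreg hR (P.complex.X n)

theorem cochainReduction_compatible (n : ℕ) : CompleteReduction.Compatible
    (q.cochainReduction hreg hR P tf ρ ρ_surj ρ_eq_zero n)
    (q.cochainReduction hreg hR P tf ρ ρ_surj ρ_eq_zero (n + 1))
    (P.homD (ModuleCat.of R R) n)
    ((q.redResolution P hreg tf ρ ρ_surj ρ_eq_zero).homD (ModuleCat.of S S) n) := by
  cases n with
  | zero =>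
    constructor <;> intro a <;> simp [Subsingleton.elim a 0]
  | succ n =>
    constructor
    · intro f
      exact (Category.assoc (P.complex.d (n + 1) n) _ _).symm
    · intro f
      exact q.redHom_comp (P.complex.d (n + 1) n) f

end Main

end CentralQuotient

namespace CategoryTheory.ProjectiveResolution

open Abelian

variable {R X : Type v} [Ring R] [AddCommGroup X] [Module R X]
  (P : ProjectiveResolution (ModuleCat.of R X))

/-- `ExtReg` as the cohomology of `Hom(P, R)`. -/
def cohomologyOfExtReg (n : ℕ) : CohomologyOf (P.homD (ModuleCat.of R R) n)
    (P.homD (ModuleCat.of R R) (n + 1)) (ExtReg R X n) :=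
  P.cohomologyOfExt (ModuleCat.of R R) n

theorem comp_rightMul_mem_ker {n : ℕ} (f : (P.homD (ModuleCat.of R R) (n + 1)).ker) (r : R) :
    P.homD (ModuleCat.of R R) (n + 1)
      ((show P.complex.X n ⟶ ModuleCat.of R R from f.1) ≫ ExtReg.rightMul r) = 0 := by
  have h1 : P.complex.d (n + 1) n ≫ (show P.complex.X n ⟶ ModuleCat.of R R from f.1) = 0 := f.2
  exact (Category.assoc _ _ _).symm.trans
    ((congrArg (· ≫ ExtReg.rightMul r) h1).trans Limits.zero_comp)

theorem op_smul_cohomologyOfExtReg_cl {n : ℕ} (f : (P.homD (ModuleCat.of R R) (n + 1)).ker)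
    (r : R) : MulOpposite.op r • (P.cohomologyOfExtReg n).cl f = (P.cohomologyOfExtReg n).cl
      ⟨(show P.complex.X n ⟶ ModuleCat.of R R from f.1) ≫ ExtReg.rightMul r,
        P.comp_rightMul_mem_ker f r⟩ :=
  P.extMk_comp_mk₀ _ (n + 1) rfl f.2 _

end CategoryTheory.ProjectiveResolution

namespace Quantisation

variable {k : Type*} [CommRing k] {A U Ah Uh : Type*} [Ring A] [Algebra k A] [Ring U] [Algebra k U]
  [Ring Ah] [Algebra k⟦X⟧ Ah] [Ring Uh] [Algebra k⟦X⟧ Uh]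
  {B : LeftBialgebroid k A U} {Bh : TopLeftBialgebroid k Ah Uh} (Q : Quantisation B Bh)

/-- The reduction `Uh → U` as a quotient by the central element `h`. -/
def centralQuotient : CentralQuotient Uh U where
  π := Q.redU
  h := algebraMap k⟦X⟧ Uh PowerSeries.X
  surjective u := by
    obtain ⟨x, hx⟩ : ∃ x : FormalSeries U, x.coeff 0 = u := ⟨fun _ => u, rfl⟩
    exact ⟨Q.isoU.symm x, by rw [Q.redU_apply, LinearEquiv.apply_symm_apply, hx]⟩
  comm r := Algebra.commutes _ r
  eq_zero_iff r := by
    rw [Q.redU_apply, FormalSeries.coeff_zero_eq_zero_iff (k := k)]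
    constructor
    · rintro ⟨m, hm⟩
      refine ⟨Q.isoU.symm m, ?_⟩
      rw [← Algebra.smul_def, ← map_smul, ← hm, LinearEquiv.symm_apply_apply]
    · rintro ⟨r', rfl⟩
      exact ⟨Q.isoU r', by rw [← Algebra.smul_def, map_smul]⟩

theorem redU_algebraMap (f : k⟦X⟧) :
    Q.redU (algebraMap k⟦X⟧ Uh f) = algebraMap k U (PowerSeries.constantCoeff f) := by
  rw [Algebra.algebraMap_eq_smul_one, Q.redU_apply, map_smul, FormalSeries.coeff_zero_smul,
    ← Q.redU_apply, map_one, Algebra.algebraMap_eq_smul_one]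

theorem algebraMap_X_mul_eq_zero (Q : Quantisation B Bh) (r : Uh)
    (hr : algebraMap k⟦X⟧ Uh PowerSeries.X * r = 0) :
    r = 0 := by
  rw [← Algebra.smul_def] at hr
  refine Q.isoU.injective (FormalSeries.X_smul_injective (k := k) ?_)
  dsimp only
  rw [← map_smul, hr, map_zero, smul_zero]

theorem isDerivedComplete_total (Q : Quantisation B Bh) :
    IsDerivedComplete (AddMonoidHom.mulLeft (algebraMap k⟦X⟧ Uh PowerSeries.X)) :=
  (FormalSeries.isDerivedComplete_X k U).of_addEquiv Q.isoU.toAddEquiv fun x =>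
    (congrArg Q.isoU (Algebra.smul_def (PowerSeries.X : k⟦X⟧) x).symm).trans (map_smul _ _ _)

theorem algebraMap_smul_base (f : k⟦X⟧) (a : Ah) :
    algebraMap k⟦X⟧ Uh f • (show Bh.Base from a) = (show Bh.Base from f • a) := by
  change Bh.counit (algebraMap k⟦X⟧ Uh f * Bh.s a) = f • a
  rw [← Algebra.smul_def, map_smul, Bh.counit_s]

/-- The reduction `Ah → A` as a semilinear map. -/
def redBase : Bh.Base →ₛₗ[Q.centralQuotient.π] B.Base where
  toFun := Q.redA
  map_add' := map_add Q.redA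
  map_smul' u a := by
    have h : ∀ a : Ah, Q.redA (Bh.counit (u * Bh.s a)) = B.counit (Q.redU u * B.s (Q.redA a)) :=
      fun a => by rw [Q.map_counit, map_mul, Q.map_s]
    exact h a

theorem redBase_surjective : Function.Surjective Q.redBase := by
  intro a
  obtain ⟨x, hx⟩ : ∃ x : FormalSeries A, x.coeff 0 = a := ⟨fun _ => a, rfl⟩
  refine ⟨Q.isoA.symm x, ?_⟩
  change Q.redA _ = _
  rw [Q.redA_apply, LinearEquiv.apply_symm_apply, hx]

theorem exists_eq_smul_of_redBase_eq_zero (a : Bh.Base) (ha : Q.redBase a = 0) :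
    ∃ b : Bh.Base, a = algebraMap k⟦X⟧ Uh PowerSeries.X • b := by
  have h1 : (Q.isoA a).coeff 0 = 0 := (Q.redA_apply a).symm.trans ha
  obtain ⟨m, hm⟩ := (FormalSeries.coeff_zero_eq_zero_iff (k := k) _).1 h1
  refine ⟨Q.isoA.symm m, ?_⟩
  rw [algebraMap_smul_base, ← map_smul, ← hm]
  exact (Q.isoA.symm_apply_apply a).symm

theorem eq_zero_of_smul_base_eq_zero (Q : Quantisation B Bh) (a : Bh.Base)
    (ha : algebraMap k⟦X⟧ Uh PowerSeries.X • a = 0) : a = 0 := by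
  have h1 : (PowerSeries.X : k⟦X⟧) • (show Ah from a) = 0 :=
    (algebraMap_smul_base (Bh := Bh) PowerSeries.X a).symm.trans ha
  refine Q.isoA.injective (FormalSeries.X_smul_injective (k := k) ?_)
  dsimp only
  refine ((map_smul _ _ _).symm.trans (congrArg Q.isoA h1)).trans ?_
  exact (map_zero Q.isoA).trans
    ((smul_zero _).symm.trans (congrArg (_ • ·) (map_zero Q.isoA).symm))

end Quantisation

end

theorem mainTheorem7 {k : Type u} [CommRing k] {A U Ah Uh : Type v}
    [Ring A] [Algebra k A] [Ring U] [Algebra k U]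
    [Ring Ah] [Algebra k⟦X⟧ Ah] [Ring Uh] [Algebra k⟦X⟧ Uh]
    (B : LeftBialgebroid k A U) (Bh : TopLeftBialgebroid k Ah Uh) (Q : Quantisation B Bh)
    (hU : IsNoetherianRing U) (d : ℕ)
    (hExt : ∀ i : ℕ, i ≠ d → Subsingleton (ExtReg U B.Base i)) :
    (∀ i : ℕ, i ≠ d → Subsingleton (ExtReg Uh Bh.Base i)) ∧
    IsAdicComplete (hIdeal k) (ExtReg Uh Bh.Base d) ∧
    (∀ e : ExtReg Uh Bh.Base d, (PowerSeries.X : k⟦X⟧) • e = 0 → e = 0) ∧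
    ∃ red : ExtReg Uh Bh.Base d →+ ExtReg U B.Base d,
      Function.Surjective red ∧
      (∀ e, red e = 0 ↔ ∃ e', e = (PowerSeries.X : k⟦X⟧) • e') ∧
      (∀ (u : Uh) (e), red (MulOpposite.op u • e) = MulOpposite.op (Q.redU u) • red e) ∧
      (Module.Projective k (ExtReg U B.Base d) →
        ∃ iso : ExtReg Uh Bh.Base d ≃ₗ[k⟦X⟧] FormalSeries (ExtReg U B.Base d),
          ∀ e, red e = (iso e).coeff 0) := by
  let q := Q.centralQuotient
  have hreg : ∀ r, q.h * r = 0 → r = 0 := Q.algebraMap_X_mul_eq_zero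
  have hR : IsDerivedComplete (AddMonoidHom.mulLeft q.h) := Q.isDerivedComplete_total
  let P := CategoryTheory.projectiveResolution (ModuleCat.of Uh Bh.Base)
  let Pb := q.redResolution P hreg Q.eq_zero_of_smul_base_eq_zero Q.redBase Q.redBase_surjective
    Q.exists_eq_smul_of_redBase_eq_zero
  let K := q.cochainReduction hreg hR P Q.eq_zero_of_smul_base_eq_zero Q.redBase
    Q.redBase_surjective Q.exists_eq_smul_of_redBase_eq_zero
  have hK : ∀ n, (K n).Compatible (K (n + 1)) _ _ :=
    q.cochainReduction_compatible hreg hR P Q.eq_zero_of_smul_base_eq_zero Q.redBase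
      Q.redBase_surjective Q.exists_eq_smul_of_redBase_eq_zero
  have hcl : ∀ n (f : (P.homD (ModuleCat.of Uh Uh) (n + 1)).ker),
      DistribSMul.toAddMonoidHom (ExtReg Uh Bh.Base n) (PowerSeries.X : k⟦X⟧)
        ((P.cohomologyOfExtReg n).cl f) =
      (P.cohomologyOfExtReg n).cl ⟨(K (n + 1)).h f, (hK (n + 1)).h_mem_ker f⟩ :=
    fun n f => P.op_smul_cohomologyOfExtReg_cl f q.h
  have hsub : ∀ i, i ≠ d → Subsingleton (ExtReg Uh Bh.Base i) := fun i hi => by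
    have := hExt i hi
    exact (hK i).subsingleton_cohomology (P.cohomologyOfExtReg i) (Pb.cohomologyOfExtReg i)
      (hK (i + 1)) (hcl i) (P.homD_homD _ i)
  have hDC := (hK d).isDerivedComplete_cohomology (P.cohomologyOfExtReg d) (hK (d + 1)) (hcl d)
  have tf : ∀ e : ExtReg Uh Bh.Base d, (PowerSeries.X : k⟦X⟧) • e = 0 → e = 0 := by
    refine (hK d).eq_zero_of_h_eq_zero (P.cohomologyOfExtReg d) (hK (d + 1)) (hcl d) ?_
    cases d with
    | zero => exact fun a _ => ⟨0, 0, map_zero _, Subsingleton.elim _ _⟩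
    | succ n =>
      exact (hK n).exists_lift_of_exact_red (P.homD_homD _ n)
        ((Pb.cohomologyOfExtReg n).exact_iff_subsingleton.2 (hExt n (by omega))) (hK (n + 1))
  obtain ⟨red, red_surj, red_eq_zero, red_cl⟩ := (hK d).exists_red_cohomology
    (P.cohomologyOfExtReg d) (Pb.cohomologyOfExtReg d) (hK (d + 1)) (hcl d) (P.homD_homD _ d)
    ((hK (d + 1)).exists_lift_of_exact (hK (d + 2)) (P.homD_homD _ (d + 1))
      ((P.cohomologyOfExtReg (d + 1)).exact_iff_subsingleton.2 (hsub (d + 1) (by omega))))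
  have red_op : ∀ (u : Uh) (e : ExtReg Uh Bh.Base d),
      red (MulOpposite.op u • e) = MulOpposite.op (Q.redU u) • red e := fun u e => by
    obtain ⟨f, rfl⟩ := (P.cohomologyOfExtReg d).cl_surjective e
    rw [P.op_smul_cohomologyOfExtReg_cl, red_cl, red_cl]
    refine Eq.trans ?_ (Pb.op_smul_cohomologyOfExtReg_cl _ _).symm
    exact congrArg _ (Subtype.ext (q.redHom_comp_rightMul (P.complex.X d) f.1 u))
  refine ⟨hsub, isAdicComplete_of_isDerivedComplete hDC tf, tf, red, red_surj, red_eq_zero, red_op,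
    fun hproj => exists_equiv_formalSeries hDC tf red red_surj red_eq_zero fun f e => ?_⟩
  rw [ExtReg.algebraMap_smul_def, red_op, Q.redU_algebraMap, ← ExtReg.algebraMap_smul_def]
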